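/- Let $\mathcal H$ be a complex Hilbert space and let $\mathbf T=(T_1,T_2)$ be a commuting pair of bounded linear operators on $\mathcal H$. Put $P:=\sqrt{T_1^*T_1+T_2^*T_2}$ and let $T_i=V_iP$ $(i=1,2)$ be the canonical joint polar decomposition of $\mathbf T$: the column operator $\binom{V_1}{V_2}:\mathcal H\to\mathcal H\oplus\mathcal H$ is a partial isometry and $\ker T_1\cap\ker T_2=\ker V_1\cap\ker V_2=\ker P$. Let $\widehat{\mathbf T}:=(\sqrt P\,V_1\sqrt P,\ \sqrt P\,V_2\sqrt P)$ be the spherical Aluthge transform of $\mathbf T$, which is again a commuting pair. For a commuting pair $\mathbf S=(S_1,S_2)$ on $\mathcal H$, the Koszul complex is $$0\longrightarrow\mathcal H\xrightarrow{\ \binom{S_1}{S_2}\ }\mathcal H\oplus\mathcal H\xrightarrow{\ (-S_2\ \ S_1)\ }\mathcal H\longrightarrow 0 .$$ Call $\mathbf S$ Fredholm if each map of this complex has closed range and its homology spaces $H^0,H^1,H^2$ are finite-dimensional; in that case let $\operatorname{ind}\mathbf S:=\dim H^0-\dim H^1+\dim H^2$. For $\lambda=(\lambda_1,\lambda_2)\in\mathbb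 C^2$ write $\mathbf S-\lambda:=(S_1-\lambda_1,S_2-\lambda_2)$, and let the Taylor essential spectrum be $$\sigma_{Te}(\mathbf S):=\{\lambda\in\mathbb C^2:\ \mathbf S-\lambda\text{ is not Fredholm}\}.$$ Then $$\sigma_{Te}(\mathbf T)=\sigma_{Te}(\widehat{\mathbf T}),$$ and for every $\lambda\notin\sigma_{Te}(\mathbf T)$, $$\operatorname{ind}(\mathbf T-\lambda)=\operatorname{ind}(\widehat{\mathbf T}-\lambda).$$ -/

import Mathlib

open ContinuousLinearMap

/-- A commuting pair of bounded operators on `H`. -/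
@[ext]
structure CommutingPair (H : Type*) [NormedAddCommGroup H] [InnerProductSpace ℂ H] where
  fst : H →L[ℂ] H
  snd : H →L[ℂ] H
  comm : fst * snd = snd * fst

namespace CommutingPair

section Koszul

variable {H : Type*} [NormedAddCommGroup H] [InnerProductSpace ℂ H]

/-- The pair `T - λ = (T₁ - λ₁, T₂ - λ₂)`. -/
def translate (T : CommutingPair H) (l : ℂ × ℂ) : CommutingPair H where
  fst := T.fst - l.1 • (1 : H →L[ℂ] H)
  snd := T.snd - l.2 • (1 : H →L[ℂ] H)
  comm := by
    have h := T.comm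
    simp only [sub_mul, mul_sub, smul_mul_assoc, mul_smul_comm, one_mul, mul_one, h, smul_sub,
      smul_comm l.2 l.1]
    abel

/-- First map `x ↦ (T₁ x, T₂ x)` of the Koszul complex `0 → H → H ⊕ H → H → 0`. -/
def d₀ (T : CommutingPair H) : H →L[ℂ] H × H := T.fst.prod T.snd

/-- Second map `(x, y) ↦ - T₂ x + T₁ y` of the Koszul complex `0 → H → H ⊕ H → H → 0`. -/
def d₁ (T : CommutingPair H) : H × H →L[ℂ] H := (-T.snd).coprod T.fst

theorem d₁_comp_d₀ (T : CommutingPair H) : T.d₁ ∘L T.d₀ = 0 := by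
  ext x
  have h := congrArg (fun A : H →L[ℂ] H => A x) T.comm
  simp only [mul_apply_eq_comp] at h
  simp [d₀, d₁, h]

/-- Homology of the Koszul complex at the left-hand `H`. -/
abbrev H₀ (T : CommutingPair H) : Type _ := LinearMap.ker (T.d₀ : H →ₗ[ℂ] H × H)

/-- Homology of the Koszul complex at `H ⊕ H`: the quotient `ker d₁ / ran d₀`. -/
abbrev H₁ (T : CommutingPair H) : Type _ :=
  LinearMap.ker (T.d₁ : H × H →ₗ[ℂ] H) ⧸
    (LinearMap.range (T.d₀ : H →ₗ[ℂ] H × H)).comap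
      (LinearMap.ker (T.d₁ : H × H →ₗ[ℂ] H)).subtype

/-- Homology of the Koszul complex at the right-hand `H`. -/
abbrev H₂ (T : CommutingPair H) : Type _ := H ⧸ LinearMap.range (T.d₁ : H × H →ₗ[ℂ] H)

/-- `T` is Fredholm: all maps of its Koszul complex have closed range and all the homology
quotients are finite-dimensional. -/
structure IsFredholm (T : CommutingPair H) : Prop where
  isClosed_range_d₀ : IsClosed (Set.range T.d₀)
  isClosed_range_d₁ : IsClosed (Set.range T.d₁)
  finite_H₀ : FiniteDimensional ℂ T.H₀
  finite_H₁ : FiniteDimensional ℂ T.H₁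
  finite_H₂ : FiniteDimensional ℂ T.H₂

/-- The Taylor essential spectrum. -/
def essentialSpectrum (T : CommutingPair H) : Set (ℂ × ℂ) :=
  {l | ¬ (T.translate l).IsFredholm}

/-- The Fredholm index: the Euler characteristic of the Koszul complex (meaningful when `T` is
Fredholm). -/
noncomputable def index (T : CommutingPair H) : ℤ :=
  (Module.finrank ℂ T.H₀ : ℤ) - Module.finrank ℂ T.H₁ + Module.finrank ℂ T.H₂

end Koszul

section Aluthge

variable {H : Type*} [NormedAddCommGroup H] [InnerProductSpace ℂ H] [CompleteSpace H]

/-- `P = √(T₁* T₁ + T₂* T₂)`. -/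
noncomputable def P (T : CommutingPair H) : H →L[ℂ] H :=
  CFC.sqrt (adjoint T.fst * T.fst + adjoint T.snd * T.snd)

/-- `√P`. -/
noncomputable def sqrtP (T : CommutingPair H) : H →L[ℂ] H := CFC.sqrt T.P

/-- `V` is the partial isometric part of the canonical joint polar decomposition `Tᵢ = Vᵢ P`:
the column `(V₁, V₂)` is a partial isometry (isometric on the orthogonal complement of its kernel)
and `ker T₁ ∩ ker T₂ = ker V₁ ∩ ker V₂ = ker P`. -/
structure IsCanonicalPolar (T : CommutingPair H) (V : (H →L[ℂ] H) × (H →L[ℂ] H)) : Prop where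
  fst_eq : T.fst = V.1 * T.P
  snd_eq : T.snd = V.2 * T.P
  isometric : ∀ x ∈ (V.1.ker ⊓ V.2.ker)ᗮ, ‖V.1 x‖ ^ 2 + ‖V.2 x‖ ^ 2 = ‖x‖ ^ 2
  ker_T : T.fst.ker ⊓ T.snd.ker = T.P.ker
  ker_V : V.1.ker ⊓ V.2.ker = T.P.ker

theorem P_isSelfAdjoint (T : CommutingPair H) : adjoint T.P = T.P :=
  (IsSelfAdjoint.of_nonneg (CFC.sqrt_nonneg _) : IsSelfAdjoint T.P)

theorem sqrtP_mul_sqrtP (T : CommutingPair H) : T.sqrtP * T.sqrtP = T.P :=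
  CFC.sqrt_mul_sqrt_self _ (CFC.sqrt_nonneg _)

theorem sqrtP_isSelfAdjoint (T : CommutingPair H) : adjoint T.sqrtP = T.sqrtP :=
  (IsSelfAdjoint.of_nonneg (CFC.sqrt_nonneg _) : IsSelfAdjoint T.sqrtP)

theorem P_mul_P (T : CommutingPair H) :
    T.P * T.P = adjoint T.fst * T.fst + adjoint T.snd * T.snd :=
  CFC.sqrt_mul_sqrt_self _ (add_nonneg (star_mul_self_nonneg T.fst) (star_mul_self_nonneg T.snd))

theorem norm_P_sq (T : CommutingPair H) (x : H) :
    ‖T.P x‖ ^ 2 = ‖T.fst x‖ ^ 2 + ‖T.snd x‖ ^ 2 := by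
  have h := congrArg (fun A : H →L[ℂ] H => RCLike.re (inner ℂ (A x) x)) T.P_mul_P
  have e : T.P * T.P = adjoint T.P * T.P := by rw [T.P_isSelfAdjoint]
  rw [e] at h
  simp only [mul_apply_eq_comp, add_apply, inner_add_left,
    map_add, ContinuousLinearMap.adjoint_inner_left, inner_self_eq_norm_sq] at h
  exact h

/-- Two operators that agree on the range and on the kernel of `P` are equal. -/
theorem eq_of_mul_P_eq (T : CommutingPair H) {A B : H →L[ℂ] H} (h : A * T.P = B * T.P)
    (hk : ∀ x, T.P x = 0 → A x = B x) : A = B := by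
  have hr : T.P.rangeᗮ = T.P.ker := by rw [orthogonal_range, P_isSelfAdjoint]
  have hcl : T.P.range.topologicalClosure ≤ (A - B).ker := by
    refine Submodule.topologicalClosure_minimal _ ?_ (A - B).isClosed_ker
    rintro _ ⟨x, rfl⟩
    have := congrArg (fun C : H →L[ℂ] H => C x) h
    simpa [sub_eq_zero] using this
  have hkl : T.P.range.topologicalClosureᗮ ≤ (A - B).ker := by
    rw [Submodule.orthogonal_closure, hr]
    intro x hx
    simpa [sub_eq_zero] using hk x hx
  have : CompleteSpace T.P.range.topologicalClosure :=
    (Submodule.isClosed_topologicalClosure _).completeSpace_coe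
  have htop : (⊤ : Submodule ℂ H) ≤ (A - B).ker := by
    rw [← Submodule.sup_orthogonal_of_hasOrthogonalProjection
      (K := T.P.range.topologicalClosure)]
    exact sup_le hcl hkl
  ext x
  simpa [sub_eq_zero] using htop (Submodule.mem_top (x := x))

/-- An operator dominated by `P` factors through `P`. -/
theorem exists_factor (T : CommutingPair H) (A : H →L[ℂ] H) (hA : ∀ x, ‖A x‖ ≤ ‖T.P x‖) :
    ∃ V : H →L[ℂ] H, A = V * T.P ∧ ∀ x, T.P x = 0 → V x = 0 := by
  let K := T.P.range.topologicalClosure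
  have : CompleteSpace K := (Submodule.isClosed_topologicalClosure _).completeSpace_coe
  have hmem : ∀ x, T.P x ∈ K := fun x =>
    Submodule.le_topologicalClosure _ (LinearMap.mem_range_self (T.P : H →ₗ[ℂ] H) x)
  let e : H →ₗ[ℂ] K := (T.P : H →ₗ[ℂ] H).codRestrict K hmem
  have hd : DenseRange e := by
    rw [DenseRange, Topology.IsEmbedding.subtypeVal.isInducing.dense_iff]
    rintro ⟨y, hy⟩
    rw [← Set.range_comp]
    exact hy
  have hn : ∃ C : ℝ, ∀ x, ‖(A : H →ₗ[ℂ] H) x‖ ≤ C * ‖e x‖ := ⟨1, fun x => by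
    simpa [e] using hA x⟩
  refine ⟨((A : H →ₗ[ℂ] H).extendOfNorm e) ∘L K.orthogonalProjectionOnto, ?_, ?_⟩
  · ext x
    have h1 := LinearMap.extendOfNorm_eq hd hn x
    have h2 : K.orthogonalProjectionOnto (T.P x) = e x :=
      Submodule.orthogonalProjectionOnto_mem_subspace_eq_self (K := K) (e x)
    simp only [mul_apply_eq_comp, ContinuousLinearMap.comp_apply, h2, h1]
    rfl
  · intro x hx
    have : x ∈ Kᗮ := by
      rw [Submodule.orthogonal_closure, orthogonal_range, P_isSelfAdjoint]
      exact hx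
    simp [Submodule.orthogonalProjectionOnto_apply_of_mem_orthogonal this]

/-- The canonical joint polar decomposition exists and is unique. -/
theorem existsUnique_polar (T : CommutingPair H) : ∃! V, T.IsCanonicalPolar V := by
  have hsq := T.norm_P_sq
  have hT : T.fst.ker ⊓ T.snd.ker = T.P.ker := by
    ext x
    have h := hsq x
    simp only [Submodule.mem_inf, LinearMap.mem_ker, ContinuousLinearMap.coe_coe]
    constructor
    · rintro ⟨h1, h2⟩
      simpa [h1, h2] using h
    · intro h0
      rw [h0, norm_zero] at h
      constructor <;> rw [← norm_eq_zero] <;>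
        nlinarith [sq_nonneg ‖T.fst x‖, sq_nonneg ‖T.snd x‖]
  obtain ⟨V₁, h₁, k₁⟩ := T.exists_factor T.fst fun x =>
    le_of_sq_le_sq (by nlinarith [hsq x, sq_nonneg ‖T.snd x‖]) (norm_nonneg _)
  obtain ⟨V₂, h₂, k₂⟩ := T.exists_factor T.snd fun x =>
    le_of_sq_le_sq (by nlinarith [hsq x, sq_nonneg ‖T.fst x‖]) (norm_nonneg _)
  have hiso : ∀ x ∈ T.P.kerᗮ, ‖V₁ x‖ ^ 2 + ‖V₂ x‖ ^ 2 = ‖x‖ ^ 2 := by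
    intro x hx
    rw [orthogonal_ker, P_isSelfAdjoint] at hx
    have hc : IsClosed {x : H | ‖V₁ x‖ ^ 2 + ‖V₂ x‖ ^ 2 = ‖x‖ ^ 2} :=
      isClosed_eq (by fun_prop) (by fun_prop)
    refine closure_minimal (s := (T.P.range : Set H)) ?_ hc hx
    rintro _ ⟨y, rfl⟩
    have e₁ : T.fst y = V₁ (T.P y) := congrArg (fun A : H →L[ℂ] H => A y) h₁
    have e₂ : T.snd y = V₂ (T.P y) := congrArg (fun A : H →L[ℂ] H => A y) h₂
    have := hsq y
    rw [e₁, e₂] at this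
    exact this.symm
  have hV : V₁.ker ⊓ V₂.ker = T.P.ker := by
    apply le_antisymm
    · rintro x ⟨hx₁, hx₂⟩
      rw [← hT]
      obtain ⟨u, hu, v, hv, rfl⟩ :=
        Submodule.exists_add_mem_mem_orthogonal (K := T.P.ker) x
      have a₁ : V₁ v = 0 := by simpa [k₁ u hu] using hx₁
      have a₂ : V₂ v = 0 := by simpa [k₂ u hu] using hx₂
      have := hiso v hv
      have hv0 : v = 0 := by simpa [a₁, a₂] using this.symm
      rw [hT, hv0, add_zero]
      exact hu
    · exact fun x hx => ⟨k₁ x hx, k₂ x hx⟩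
  refine ⟨(V₁, V₂), ⟨h₁, h₂, by rw [hV]; exact hiso, hT, hV⟩, ?_⟩
  rintro ⟨W₁, W₂⟩ hW
  have hz : ∀ x, T.P x = 0 → W₁ x = 0 ∧ W₂ x = 0 := fun x hx => by
    have : x ∈ W₁.ker ⊓ W₂.ker := hW.ker_V ▸ hx
    exact this
  refine Prod.ext (T.eq_of_mul_P_eq ?_ ?_) (T.eq_of_mul_P_eq ?_ ?_)
  · exact hW.fst_eq.symm.trans h₁
  · exact fun x hx => (hz x hx).1.trans (k₁ x hx).symm
  · exact hW.snd_eq.symm.trans h₂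
  · exact fun x hx => (hz x hx).2.trans (k₂ x hx).symm

/-- The pair `(V₁, V₂)` of the canonical joint polar decomposition. -/
noncomputable def polar (T : CommutingPair H) : (H →L[ℂ] H) × (H →L[ℂ] H) :=
  T.existsUnique_polar.exists.choose

theorem polar_spec (T : CommutingPair H) : T.IsCanonicalPolar T.polar :=
  T.existsUnique_polar.exists.choose_spec

theorem polar_comm (T : CommutingPair H) :
    T.polar.1 * T.P * T.polar.2 = T.polar.2 * T.P * T.polar.1 := by
  have h := T.polar_spec
  apply T.eq_of_mul_P_eq
  · rw [mul_assoc (_ * _), mul_assoc (_ * _), ← h.fst_eq, ← h.snd_eq]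
    exact T.comm
  · intro x hx
    have hk : x ∈ T.polar.1.ker ⊓ T.polar.2.ker := h.ker_V ▸ hx
    have h1 : T.polar.1 x = 0 := hk.1
    have h2 : T.polar.2 x = 0 := hk.2
    simp [h1, h2]

/-- The spherical Aluthge transform `(√P V₁ √P, √P V₂ √P)`, again a commuting pair. -/
noncomputable def sphericalAluthge (T : CommutingPair H) : CommutingPair H where
  fst := T.sqrtP * T.polar.1 * T.sqrtP
  snd := T.sqrtP * T.polar.2 * T.sqrtP
  comm := by
    have key : ∀ A B : H →L[ℂ] H, T.sqrtP * A * T.sqrtP * (T.sqrtP * B * T.sqrtP)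
        = T.sqrtP * (A * T.P * B) * T.sqrtP := fun A B => by
      rw [← T.sqrtP_mul_sqrtP]; simp only [mul_assoc]
    rw [key, key, T.polar_comm]

end Aluthge

end CommutingPair

/-! Put `Q = √P` and `Aᵢ = Vᵢ √P`, and let `S` be the Aluthge transform. Then `Tᵢ = Aᵢ Q` and
`Sᵢ = Q Aᵢ`, so `Q` and each `Aᵢ` induce morphisms between the Koszul complexes of `T - λ` and
`S - λ`, in opposite directions. A pair acts by zero on its own Koszul homology, so
`Aᵢ Q = (Tᵢ - λᵢ) + λᵢ` and `Q Aᵢ = (Sᵢ - λᵢ) + λᵢ` act there as the scalar `λᵢ`. If `λ ≠ 0`, some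
`λᵢ` is invertible and the homologies are isomorphic.

If `λ = 0`, Fredholmness of either pair makes `Q` Fredholm. For `S` this holds because the range of
the last Koszul map lies in that of `Q`. For `T`, the column of the `Vᵢ` is injective on the closure
of the range of `P`, so closedness of the range of the first Koszul map descends to the range of
`P`, whose complement is `ker P = H⁰`. By the snake lemma, the Euler characteristic of the indices
of the maps induced by `Q` on homology is then `ind Q - 2 ind Q + ind Q = 0`. -/

section Algebra

open Function LinearMap

section ShortExact

variable {R M₁ M₂ M₃ N₁ N₂ N₃ : Type*} [CommRing R]
  [AddCommGroup M₁] [Module R M₁] [AddCommGroup M₂] [Module R M₂] [AddCommGroup M₃] [Module R M₃]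
  [AddCommGroup N₁] [Module R N₁] [AddCommGroup N₂] [Module R N₂] [AddCommGroup N₃] [Module R N₃]

/-- `0 → M₁ → M₂ → M₃ → 0` is a short exact sequence of modules. -/
structure IsShortExact (f : M₁ →ₗ[R] M₂) (g : M₂ →ₗ[R] M₃) : Prop where
  injective : Injective f
  exact : Exact f g
  surjective : Surjective g

theorem isShortExact_subtype_mkQ (p : Submodule R M₁) : IsShortExact p.subtype p.mkQ :=
  ⟨p.injective_subtype, exact_subtype_mkQ p, p.mkQ_surjective⟩

theorem isShortExact_ker_subtype_rangeRestrict (f : M₁ →ₗ[R] M₂) :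
    IsShortExact (ker f).subtype f.rangeRestrict :=
  ⟨(ker f).injective_subtype, exact_iff.2 (f.ker_rangeRestrict.trans (ker f).range_subtype.symm),
    f.surjective_rangeRestrict⟩

theorem isShortExact_inclusion_mkQ {p q : Submodule R M₁} (h : p ≤ q) :
    IsShortExact (Submodule.inclusion h) (p.comap q.subtype).mkQ where
  injective := Submodule.inclusion_injective h
  exact x := by simp [Subtype.ext_iff]
  surjective := Submodule.mkQ_surjective _

theorem isShortExact_inl_snd : IsShortExact (inl R M₁ M₂) (snd R M₁ M₂) :=
  ⟨inl_injective, Exact.inl_snd, snd_surjective⟩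

theorem finite_of_exact [IsNoetherianRing R] {f : M₁ →ₗ[R] M₂} {g : M₂ →ₗ[R] M₃}
    (h : Exact f g) [Module.Finite R M₁] [Module.Finite R M₃] : Module.Finite R M₂ :=
  .of_exact h.linearMap_rangeRestrict g.surjective_rangeRestrict

section Square

variable {d : M₁ →ₗ[R] M₂} {d' : N₁ →ₗ[R] N₂} {f : M₁ →ₗ[R] N₁} {g : M₂ →ₗ[R] N₂}

/-- The map `ker d → ker d'` induced by a commutative square `g ∘ d = d' ∘ f`. -/
def mapKer (h : g ∘ₗ d = d' ∘ₗ f) : ker d →ₗ[R] ker d' :=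
  f.restrict fun x hx => by
    rw [mem_ker, show d' (f x) = g (d x) from congr($h x).symm, mem_ker.1 hx, map_zero]

/-- The map `range d → range d'` induced by a commutative square `g ∘ d = d' ∘ f`. -/
def mapRange (h : g ∘ₗ d = d' ∘ₗ f) : range d →ₗ[R] range d' :=
  g.restrict <| by
    rintro _ ⟨x, rfl⟩
    exact ⟨f x, congr($h x).symm⟩

/-- The map `coker d → coker d'` induced by a commutative square `g ∘ d = d' ∘ f`. -/
def mapCoker (h : g ∘ₗ d = d' ∘ₗ f) : (M₂ ⧸ range d) →ₗ[R] N₂ ⧸ range d' :=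
  (range d).mapQ (range d') g <| by
    rintro _ ⟨x, rfl⟩
    exact ⟨f x, congr($h x).symm⟩

end Square

section Snake

variable {i₁ : M₁ →ₗ[R] N₁} {i₂ : M₂ →ₗ[R] N₂} {i₃ : M₃ →ₗ[R] N₃}
  {f : M₁ →ₗ[R] M₂} {g : M₂ →ₗ[R] M₃} {f' : N₁ →ₗ[R] N₂} {g' : N₂ →ₗ[R] N₃}

theorem mapKer_injective (hf : Injective f) (hl : f' ∘ₗ i₁ = i₂ ∘ₗ f) :
    Injective (mapKer hl) := fun _ _ h => Subtype.ext (hf congr(($h : M₂)))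

theorem mapCoker_surjective (hg' : Surjective g') (hr : g' ∘ₗ i₂ = i₃ ∘ₗ g) :
    Surjective (mapCoker hr) := by
  rw [← range_eq_top, mapCoker, Submodule.range_mapQ, range_eq_top.2 hg', Submodule.map_top,
    Submodule.range_mkQ]

theorem exact_mapKer (hf' : Injective f') (h : Exact f g) (hl : f' ∘ₗ i₁ = i₂ ∘ₗ f)
    (hr : g' ∘ₗ i₂ = i₃ ∘ₗ g) : Exact (mapKer hl) (mapKer hr) := by
  rintro ⟨x, hx⟩
  constructor
  · intro hgx
    obtain ⟨y, rfl⟩ := (h x).1 congr(($hgx : M₃))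
    refine ⟨⟨y, hf' ?_⟩, rfl⟩
    rw [map_zero, ← mem_ker.1 hx]
    exact congr($hl y)
  · rintro ⟨y, hy⟩
    exact Subtype.ext ((h x).2 ⟨y, congr(($hy : M₂))⟩)

theorem exact_mapCoker (hg : Surjective g) (h' : Exact f' g') (hl : f' ∘ₗ i₁ = i₂ ∘ₗ f)
    (hr : g' ∘ₗ i₂ = i₃ ∘ₗ g) : Exact (mapCoker hl) (mapCoker hr) := by
  refine (h'.exact_mapQ_iff _ _).2 ?_
  rw [← range_comp, hr, range_comp, range_eq_top.2 hg, Submodule.map_top]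
  exact inf_le_right

theorem exists_connecting (hM : IsShortExact f g) (hN : IsShortExact f' g')
    (hl : f' ∘ₗ i₁ = i₂ ∘ₗ f) (hr : g' ∘ₗ i₂ = i₃ ∘ₗ g) :
    ∃ δ : ker i₃ →ₗ[R] N₁ ⧸ range i₁, Exact (mapKer hr) δ ∧ Exact δ (mapCoker hl) :=
  ⟨SnakeLemma.δ' i₁ i₂ i₃ f g hM.exact f' g' hN.exact hl hr
      (ker i₃).subtype i₃.exact_subtype_ker_map (range i₁).mkQ i₁.exact_map_mkQ_range
      hM.surjective hN.injective,
    SnakeLemma.exact_δ'_right i₁ i₂ i₃ f g hM.exact f' g' hN.exact hl hr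
      (ker i₂).subtype i₂.exact_subtype_ker_map (ker i₃).subtype i₃.exact_subtype_ker_map
      (range i₁).mkQ i₁.exact_map_mkQ_range hM.surjective hN.injective
      (mapKer hr) rfl (ker i₃).injective_subtype,
    SnakeLemma.exact_δ'_left i₁ i₂ i₃ f g hM.exact f' g' hN.exact hl hr
      (ker i₃).subtype i₃.exact_subtype_ker_map (range i₁).mkQ i₁.exact_map_mkQ_range
      (range i₂).mkQ i₂.exact_map_mkQ_range hM.surjective hN.injective
      (mapCoker hl) (Submodule.mapQ_mkQ _ _ _) (range i₁).mkQ_surjective⟩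

end Snake

end ShortExact

section AlgFredholm

variable {K M₁ M₂ M₃ N₁ N₂ N₃ : Type*} [Field K]
  [AddCommGroup M₁] [Module K M₁] [AddCommGroup M₂] [Module K M₂] [AddCommGroup M₃] [Module K M₃]
  [AddCommGroup N₁] [Module K N₁] [AddCommGroup N₂] [Module K N₂] [AddCommGroup N₃] [Module K N₃]

/-- A linear map with finite-dimensional kernel and cokernel; no topology is involved. -/
structure IsAlgFredholm (f : M₁ →ₗ[K] M₂) : Prop where
  finite_ker : FiniteDimensional K (ker f)
  finite_coker : FiniteDimensional K (M₂ ⧸ range f)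

namespace IsAlgFredholm

theorem finiteDimensional_iff {f : M₁ →ₗ[K] M₂} (hf : IsAlgFredholm f) :
    FiniteDimensional K M₁ ↔ FiniteDimensional K M₂ := by
  have := hf.finite_ker
  have := hf.finite_coker
  constructor
  · intro _
    exact finite_of_exact f.exact_map_mkQ_range
  · intro _
    exact finite_of_exact f.exact_subtype_ker_map

variable {i₁ : M₁ →ₗ[K] N₁} {i₂ : M₂ →ₗ[K] N₂} {i₃ : M₃ →ₗ[K] N₃}
  {f : M₁ →ₗ[K] M₂} {g : M₂ →ₗ[K] M₃} {f' : N₁ →ₗ[K] N₂} {g' : N₂ →ₗ[K] N₃}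

theorem left_of_isShortExact (hM : IsShortExact f g) (hN : IsShortExact f' g')
    (hl : f' ∘ₗ i₁ = i₂ ∘ₗ f) (hr : g' ∘ₗ i₂ = i₃ ∘ₗ g)
    (h₂ : IsAlgFredholm i₂) (h₃ : IsAlgFredholm i₃) : IsAlgFredholm i₁ := by
  obtain ⟨δ, -, hδ⟩ := exists_connecting hM hN hl hr
  have := h₂.finite_ker
  have := h₂.finite_coker
  have := h₃.finite_ker
  exact ⟨.of_injective _ (mapKer_injective hM.injective hl), finite_of_exact hδ⟩

theorem middle_of_isShortExact (hM : IsShortExact f g) (hN : IsShortExact f' g')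
    (hl : f' ∘ₗ i₁ = i₂ ∘ₗ f) (hr : g' ∘ₗ i₂ = i₃ ∘ₗ g)
    (h₁ : IsAlgFredholm i₁) (h₃ : IsAlgFredholm i₃) : IsAlgFredholm i₂ := by
  have := h₁.finite_ker
  have := h₁.finite_coker
  have := h₃.finite_ker
  have := h₃.finite_coker
  exact ⟨finite_of_exact (exact_mapKer hN.injective hM.exact hl hr),
    finite_of_exact (exact_mapCoker hM.surjective hN.exact hl hr)⟩

theorem right_of_isShortExact (hM : IsShortExact f g) (hN : IsShortExact f' g')
    (hl : f' ∘ₗ i₁ = i₂ ∘ₗ f) (hr : g' ∘ₗ i₂ = i₃ ∘ₗ g)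
    (h₁ : IsAlgFredholm i₁) (h₂ : IsAlgFredholm i₂) : IsAlgFredholm i₃ := by
  obtain ⟨δ, hδ, -⟩ := exists_connecting hM hN hl hr
  have := h₁.finite_coker
  have := h₂.finite_ker
  have := h₂.finite_coker
  exact ⟨finite_of_exact hδ, .of_surjective _ (mapCoker_surjective hN.surjective hr)⟩

theorem index_eq_add_of_isShortExact (hM : IsShortExact f g) (hN : IsShortExact f' g')
    (hl : f' ∘ₗ i₁ = i₂ ∘ₗ f) (hr : g' ∘ₗ i₂ = i₃ ∘ₗ g)
    (h₁ : IsAlgFredholm i₁) (h₃ : IsAlgFredholm i₃) : i₂.index = i₁.index + i₃.index := by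
  obtain ⟨δ, hδ, hδ'⟩ := exists_connecting hM hN hl hr
  obtain ⟨_, _⟩ := middle_of_isShortExact hM hN hl hr h₁ h₃
  obtain ⟨_, _⟩ := h₁
  obtain ⟨_, _⟩ := h₃
  have := Module.sum_neg_one_pow_finrank_eq_zero_of_exact_six _ _ _ _ _
    (mapKer_injective hM.injective hl) (exact_mapKer hN.injective hM.exact hl hr) hδ hδ'
    (exact_mapCoker hM.surjective hN.exact hl hr) (mapCoker_surjective hN.surjective hr)
  simp only [index_eq_finrank_sub]
  omega

theorem prodMap {f : M₁ →ₗ[K] N₁} {g : M₂ →ₗ[K] N₂} (hf : IsAlgFredholm f)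
    (hg : IsAlgFredholm g) : IsAlgFredholm (f.prodMap g) :=
  middle_of_isShortExact isShortExact_inl_snd isShortExact_inl_snd (by ext <;> simp)
    (by ext <;> simp) hf hg

theorem index_prodMap {f : M₁ →ₗ[K] N₁} {g : M₂ →ₗ[K] N₂} (hf : IsAlgFredholm f)
    (hg : IsAlgFredholm g) : (f.prodMap g).index = f.index + g.index :=
  index_eq_add_of_isShortExact isShortExact_inl_snd isShortExact_inl_snd (by ext <;> simp)
    (by ext <;> simp) hf hg

end IsAlgFredholm

end AlgFredholm

section Complex

variable {R A B C A' B' C' : Type*} [CommRing R]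
  [AddCommGroup A] [Module R A] [AddCommGroup B] [Module R B] [AddCommGroup C] [Module R C]
  [AddCommGroup A'] [Module R A'] [AddCommGroup B'] [Module R B'] [AddCommGroup C'] [Module R C']
  {d₀ : A →ₗ[R] B} {d₁ : B →ₗ[R] C} {d₀' : A' →ₗ[R] B'} {d₁' : B' →ₗ[R] C'}
  {f₀ : A →ₗ[R] A'} {f₁ : B →ₗ[R] B'} {f₂ : C →ₗ[R] C'}

/-- The map on middle homology `ker d₁ / range d₀` induced by a morphism of three-term
complexes. -/
def mapHomology (h₀ : f₁ ∘ₗ d₀ = d₀' ∘ₗ f₀) (h₁ : f₂ ∘ₗ d₁ = d₁' ∘ₗ f₁) :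
    (ker d₁ ⧸ (range d₀).comap (ker d₁).subtype) →ₗ[R]
      ker d₁' ⧸ (range d₀').comap (ker d₁').subtype :=
  Submodule.mapQ _ _ (mapKer h₁) <| by
    rintro x ⟨y, hy⟩
    exact ⟨f₀ y, congr($h₀ y).symm.trans congr(f₁ $hy)⟩

theorem mapRange_comp_rangeRestrict (h : f₁ ∘ₗ d₀ = d₀' ∘ₗ f₀) :
    d₀'.rangeRestrict ∘ₗ f₀ = mapRange h ∘ₗ d₀.rangeRestrict :=
  LinearMap.ext fun x => Subtype.ext congr($h x).symm

theorem subtype_comp_mapRange (h : f₁ ∘ₗ d₀ = d₀' ∘ₗ f₀) :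
    (range d₀').subtype ∘ₗ mapRange h = f₁ ∘ₗ (range d₀).subtype := rfl

variable {g₀ : A' →ₗ[R] A} {g₁ : B' →ₗ[R] B} {g₂ : C' →ₗ[R] C} {c : R}

theorem mapKer_comp_mapKer_eq_smul (h : f₁ ∘ₗ d₀ = d₀' ∘ₗ f₀) (k : g₁ ∘ₗ d₀' = d₀ ∘ₗ g₀)
    (hgf : ∀ x ∈ ker d₀, g₀ (f₀ x) = c • x) : mapKer k ∘ₗ mapKer h = c • LinearMap.id :=
  LinearMap.ext fun x => Subtype.ext (hgf x x.2)

theorem mapCoker_comp_mapCoker_eq_smul (h : f₁ ∘ₗ d₀ = d₀' ∘ₗ f₀) (k : g₁ ∘ₗ d₀' = d₀ ∘ₗ g₀)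
    (hgf : ∀ x, g₁ (f₁ x) - c • x ∈ range d₀) : mapCoker k ∘ₗ mapCoker h = c • LinearMap.id :=
  Submodule.linearMap_qext _ <| LinearMap.ext fun x => (Submodule.Quotient.eq _).2 (hgf x)

theorem mapHomology_comp_mapHomology_eq_smul (h₀ : f₁ ∘ₗ d₀ = d₀' ∘ₗ f₀)
    (h₁ : f₂ ∘ₗ d₁ = d₁' ∘ₗ f₁) (k₀ : g₁ ∘ₗ d₀' = d₀ ∘ₗ g₀) (k₁ : g₂ ∘ₗ d₁' = d₁ ∘ₗ g₁)
    (hgf : ∀ x ∈ ker d₁, g₁ (f₁ x) - c • x ∈ range d₀) :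
    mapHomology k₀ k₁ ∘ₗ mapHomology h₀ h₁ = c • LinearMap.id :=
  Submodule.linearMap_qext _ <| LinearMap.ext fun x => (Submodule.Quotient.eq _).2 (hgf x x.2)

end Complex

theorem nonempty_linearEquiv_of_comp_eq_smul {K A B : Type*} [Field K]
    [AddCommGroup A] [Module K A] [AddCommGroup B] [Module K B] {φ : A →ₗ[K] B} {ψ : B →ₗ[K] A}
    {c : K} (hc : c ≠ 0) (hψφ : ψ ∘ₗ φ = c • LinearMap.id)
    (hφψ : φ ∘ₗ ψ = c • LinearMap.id) : Nonempty (A ≃ₗ[K] B) :=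
  ⟨.ofLinearMap φ (c⁻¹ • ψ) (by rw [LinearMap.comp_smul, hφψ, inv_smul_smul₀ hc])
    (by rw [LinearMap.smul_comp, hψφ, inv_smul_smul₀ hc])⟩

section IndexOfComplex

variable {K A B C A' B' C' : Type*} [Field K]
  [AddCommGroup A] [Module K A] [AddCommGroup B] [Module K B] [AddCommGroup C] [Module K C]
  [AddCommGroup A'] [Module K A'] [AddCommGroup B'] [Module K B'] [AddCommGroup C'] [Module K C']
  {d₀ : A →ₗ[K] B} {d₁ : B →ₗ[K] C} {d₀' : A' →ₗ[K] B'} {d₁' : B' →ₗ[K] C'}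
  {f₀ : A →ₗ[K] A'} {f₁ : B →ₗ[K] B'} {f₂ : C →ₗ[K] C'}

theorem isAlgFredholm_mapRange (h : f₁ ∘ₗ d₀ = d₀' ∘ₗ f₀) (hf₀ : IsAlgFredholm f₀)
    (hf₁ : IsAlgFredholm f₁) : IsAlgFredholm (mapRange h) where
  finite_ker :=
    have := hf₁.finite_ker
    .of_injective (mapKer (subtype_comp_mapRange h))
      (mapKer_injective (range d₀).injective_subtype _)
  finite_coker :=
    have := hf₀.finite_coker
    .of_surjective (mapCoker (mapRange_comp_rangeRestrict h))
      (mapCoker_surjective d₀'.surjective_rangeRestrict _)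

theorem isAlgFredholm_mapKer (h : f₁ ∘ₗ d₀ = d₀' ∘ₗ f₀) (hf₀ : IsAlgFredholm f₀)
    (hf₁ : IsAlgFredholm f₁) : IsAlgFredholm (mapKer h) :=
  .left_of_isShortExact (isShortExact_ker_subtype_rangeRestrict d₀)
    (isShortExact_ker_subtype_rangeRestrict d₀') rfl (mapRange_comp_rangeRestrict h) hf₀
    (isAlgFredholm_mapRange h hf₀ hf₁)

theorem isAlgFredholm_mapCoker (h : f₁ ∘ₗ d₀ = d₀' ∘ₗ f₀) (hf₀ : IsAlgFredholm f₀)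
    (hf₁ : IsAlgFredholm f₁) : IsAlgFredholm (mapCoker h) :=
  .right_of_isShortExact (isShortExact_subtype_mkQ (range d₀))
    (isShortExact_subtype_mkQ (range d₀')) rfl rfl (isAlgFredholm_mapRange h hf₀ hf₁) hf₁

theorem isAlgFredholm_mapHomology (h₀ : f₁ ∘ₗ d₀ = d₀' ∘ₗ f₀) (h₁ : f₂ ∘ₗ d₁ = d₁' ∘ₗ f₁)
    (hd : d₁ ∘ₗ d₀ = 0) (hd' : d₁' ∘ₗ d₀' = 0) (hf₀ : IsAlgFredholm f₀) (hf₁ : IsAlgFredholm f₁)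
    (hf₂ : IsAlgFredholm f₂) : IsAlgFredholm (mapHomology h₀ h₁) :=
  .right_of_isShortExact (isShortExact_inclusion_mkQ (range_le_ker_iff.2 hd))
    (isShortExact_inclusion_mkQ (range_le_ker_iff.2 hd')) rfl rfl
    (isAlgFredholm_mapRange h₀ hf₀ hf₁) (isAlgFredholm_mapKer h₁ hf₁ hf₂)

theorem index_eq_index_mapKer_add_index_mapRange (h : f₁ ∘ₗ d₀ = d₀' ∘ₗ f₀)
    (hf₀ : IsAlgFredholm f₀) (hf₁ : IsAlgFredholm f₁) :
    f₀.index = (mapKer h).index + (mapRange h).index :=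
  IsAlgFredholm.index_eq_add_of_isShortExact (isShortExact_ker_subtype_rangeRestrict d₀)
    (isShortExact_ker_subtype_rangeRestrict d₀') rfl (mapRange_comp_rangeRestrict h)
    (isAlgFredholm_mapKer h hf₀ hf₁) (isAlgFredholm_mapRange h hf₀ hf₁)

theorem index_eq_index_mapRange_add_index_mapCoker (h : f₁ ∘ₗ d₀ = d₀' ∘ₗ f₀)
    (hf₀ : IsAlgFredholm f₀) (hf₁ : IsAlgFredholm f₁) :
    f₁.index = (mapRange h).index + (mapCoker h).index :=
  IsAlgFredholm.index_eq_add_of_isShortExact (isShortExact_subtype_mkQ (range d₀))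
    (isShortExact_subtype_mkQ (range d₀')) rfl rfl (isAlgFredholm_mapRange h hf₀ hf₁)
    (isAlgFredholm_mapCoker h hf₀ hf₁)

theorem index_mapKer_eq_index_mapRange_add_index_mapHomology (h₀ : f₁ ∘ₗ d₀ = d₀' ∘ₗ f₀)
    (h₁ : f₂ ∘ₗ d₁ = d₁' ∘ₗ f₁) (hd : d₁ ∘ₗ d₀ = 0) (hd' : d₁' ∘ₗ d₀' = 0)
    (hf₀ : IsAlgFredholm f₀) (hf₁ : IsAlgFredholm f₁) (hf₂ : IsAlgFredholm f₂) :
    (mapKer h₁).index = (mapRange h₀).index + (mapHomology h₀ h₁).index :=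
  IsAlgFredholm.index_eq_add_of_isShortExact (isShortExact_inclusion_mkQ (range_le_ker_iff.2 hd))
    (isShortExact_inclusion_mkQ (range_le_ker_iff.2 hd')) rfl rfl
    (isAlgFredholm_mapRange h₀ hf₀ hf₁)
    (isAlgFredholm_mapHomology h₀ h₁ hd hd' hf₀ hf₁ hf₂)

theorem index_mapKer_sub_index_mapHomology_add_index_mapCoker (h₀ : f₁ ∘ₗ d₀ = d₀' ∘ₗ f₀)
    (h₁ : f₂ ∘ₗ d₁ = d₁' ∘ₗ f₁) (hd : d₁ ∘ₗ d₀ = 0) (hd' : d₁' ∘ₗ d₀' = 0)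
    (hf₀ : IsAlgFredholm f₀) (hf₁ : IsAlgFredholm f₁) (hf₂ : IsAlgFredholm f₂) :
    (mapKer h₀).index - (mapHomology h₀ h₁).index + (mapCoker h₁).index =
      f₀.index - f₁.index + f₂.index := by
  rw [index_eq_index_mapKer_add_index_mapRange h₀ hf₀ hf₁,
    index_eq_index_mapKer_add_index_mapRange h₁ hf₁ hf₂,
    index_eq_index_mapRange_add_index_mapCoker h₁ hf₁ hf₂,
    index_mapKer_eq_index_mapRange_add_index_mapHomology h₀ h₁ hd hd' hf₀ hf₁ hf₂]
  ring

end IndexOfComplex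

end Algebra

section ClosedRange

open Set

theorem isClosed_range_of_isClosed_range_comp {X Y Z : Type*} [TopologicalSpace Y]
    [TopologicalSpace Z] {f : X → Y} {g : Y → Z} (hg : Continuous g)
    (hinj : InjOn g (closure (range f))) (h : IsClosed (range (g ∘ f))) : IsClosed (range f) := by
  refine isClosed_of_closure_subset fun y hy => ?_
  have hgy : g y ∈ range (g ∘ f) := by
    rw [← h.closure_eq, range_comp]
    exact image_closure_subset_closure_image hg (mem_image_of_mem g hy)
  obtain ⟨x, hx⟩ := hgy
  exact ⟨x, hinj (subset_closure (mem_range_self x)) hy hx⟩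

section Banach

variable {𝕜 E F : Type*} [NontriviallyNormedField 𝕜]
  [NormedAddCommGroup E] [NormedSpace 𝕜 E] [CompleteSpace E]
  [NormedAddCommGroup F] [NormedSpace 𝕜 F] [CompleteSpace F]

theorem isClosed_range_of_isCompl (f : E →L[𝕜] F) (G : Submodule 𝕜 F) (h : IsCompl f.range G)
    (hG : IsClosed (G : Set F)) : IsClosed (f.range : Set F) := by
  have : IsClosed (f.ker : Set E) := f.isClosed_ker
  let f' : E ⧸ f.ker →L[𝕜] F := ⟨f.ker.liftQ f le_rfl, f.continuous.quotient_lift _⟩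
  have hrange : f'.range = f.range := f.ker.range_liftQ (f : E →ₗ[𝕜] F) le_rfl
  have hker : f'.ker = ⊥ := f.ker.ker_liftQ_eq_bot (f : E →ₗ[𝕜] F) le_rfl le_rfl
  rw [← hrange] at h ⊢
  exact f'.closed_complemented_range_of_isCompl_of_ker_eq_bot G h hG hker

theorem isClosed_range_of_cofg [CompleteSpace 𝕜] (f : E →L[𝕜] F) (hf : f.range.CoFG) :
    IsClosed (f.range : Set F) := by
  obtain ⟨G, hG⟩ := f.range.exists_isCompl
  have : FiniteDimensional 𝕜 G := Module.Finite.iff_fg.2 (hf.fg_of_isCompl hG)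
  exact isClosed_range_of_isCompl f G hG G.closed_of_finiteDimensional

end Banach

section Normal

variable {𝕜 E : Type*} [RCLike 𝕜] [NormedAddCommGroup E] [InnerProductSpace 𝕜 E]
  [CompleteSpace E] {Q : E →L[𝕜] E}

theorem IsAlgFredholm.of_isStarNormal_of_cofg (hQ : IsStarNormal Q) (h : Q.range.CoFG) :
    IsAlgFredholm (Q : E →ₗ[𝕜] E) := by
  have hdisj : Disjoint Q.range Q.ker :=
    hQ.orthogonal_range ▸ Q.range.orthogonal_disjoint
  exact ⟨Module.Finite.iff_fg.2 (h.fg_of_disjoint hdisj.symm), h⟩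

theorem cofg_range_of_isStarNormal (hQ : IsStarNormal Q) (hker : Q.ker.FG)
    (hcl : IsClosed (Q.range : Set E)) : Q.range.CoFG := by
  have : CompleteSpace Q.range := hcl.completeSpace_coe
  have hcompl : IsCompl Q.range Q.ker :=
    hQ.orthogonal_range ▸ Submodule.isCompl_orthogonal (K := Q.range)
  exact hker.cofg_of_isCompl hcompl.symm

end Normal

end ClosedRange

namespace CommutingPair

section Homology

variable {H K : Type*} [NormedAddCommGroup H] [InnerProductSpace ℂ H]
  [NormedAddCommGroup K] [InnerProductSpace ℂ K]

theorem translate_zero (S : CommutingPair H) : S.translate 0 = S := by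
  ext <;> simp [translate]

theorem isFredholm_iff [CompleteSpace H] (S : CommutingPair H) : S.IsFredholm ↔
    FiniteDimensional ℂ S.H₀ ∧ FiniteDimensional ℂ S.H₁ ∧ FiniteDimensional ℂ S.H₂ := by
  refine ⟨fun h => ⟨h.finite_H₀, h.finite_H₁, h.finite_H₂⟩, fun ⟨h₀, h₁, h₂⟩ =>
    ⟨?_, isClosed_range_of_cofg _ h₂, h₀, h₁, h₂⟩⟩
  have hcl : IsClosed (S.d₁.ker : Set (H × H)) := S.d₁.isClosed_ker
  have : CompleteSpace S.d₁.ker := hcl.completeSpace_coe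
  let D : H →L[ℂ] S.d₁.ker := S.d₀.codRestrict _ fun x => congr($S.d₁_comp_d₀ x)
  have hD : D.range.CoFG := by
    rw [show D.range = S.d₀.range.comap S.d₁.ker.subtype from LinearMap.range_codRestrict _ _ _]
    exact h₁
  have hrange := hcl.isClosedEmbedding_subtypeVal.isClosedMap _ (isClosed_range_of_cofg D hD)
  rwa [LinearMap.coe_range, ← Set.range_comp] at hrange

/-- `S` and `S'` are simultaneously Fredholm, and then have the same index. -/
structure FredholmEquivalent (S : CommutingPair H) (S' : CommutingPair K) : Prop where
  isFredholm_iff : S.IsFredholm ↔ S'.IsFredholm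
  index_eq : S.IsFredholm → S.index = S'.index

/-- `Q` intertwines `S` and `S'`, hence induces a morphism of their Koszul complexes. -/
structure Intertwines (Q : H →L[ℂ] K) (S : CommutingPair H) (S' : CommutingPair K) : Prop where
  fst : Q ∘L S.fst = S'.fst ∘L Q
  snd : Q ∘L S.snd = S'.snd ∘L Q

/-- `E` induces the zero map on the homology of the Koszul complex of `S`. -/
structure VanishesOnHomology (S : CommutingPair H) (E : H →L[ℂ] H) : Prop where
  on_H₀ : ∀ x, S.d₀ x = 0 → E x = 0
  on_H₁ : ∀ v, S.d₁ v = 0 → (E v.1, E v.2) ∈ S.d₀.range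
  on_H₂ : ∀ x, E x ∈ S.d₁.range

theorem d₁_eq_zero_iff (S : CommutingPair H) (v : H × H) : S.d₁ v = 0 ↔ S.snd v.1 = S.fst v.2 := by
  simp [d₁, neg_add_eq_zero]

theorem vanishesOnHomology_fst (S : CommutingPair H) : S.VanishesOnHomology S.fst where
  on_H₀ _ hx := congrArg Prod.fst hx
  on_H₁ v hv := ⟨v.1, Prod.ext rfl ((S.d₁_eq_zero_iff v).1 hv)⟩
  on_H₂ x := ⟨(0, x), by simp [d₁]⟩

theorem vanishesOnHomology_snd (S : CommutingPair H) : S.VanishesOnHomology S.snd where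
  on_H₀ _ hx := congrArg Prod.snd hx
  on_H₁ v hv := ⟨v.2, Prod.ext ((S.d₁_eq_zero_iff v).1 hv).symm rfl⟩
  on_H₂ x := ⟨(-x, 0), by simp [d₁]⟩

variable {S : CommutingPair H} {S' : CommutingPair K} {Q : H →L[ℂ] K} {A : K →L[ℂ] H}

theorem Intertwines.comp_d₀ (h : Intertwines Q S S') :
    (Q : H →ₗ[ℂ] K).prodMap (Q : H →ₗ[ℂ] K) ∘ₗ (S.d₀ : H →ₗ[ℂ] H × H) =
      (S'.d₀ : K →ₗ[ℂ] K × K) ∘ₗ (Q : H →ₗ[ℂ] K) :=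
  LinearMap.ext fun x => Prod.ext congr($h.fst x) congr($h.snd x)

theorem Intertwines.comp_d₁ (h : Intertwines Q S S') :
    (Q : H →ₗ[ℂ] K) ∘ₗ (S.d₁ : H × H →ₗ[ℂ] H) =
      (S'.d₁ : K × K →ₗ[ℂ] K) ∘ₗ (Q : H →ₗ[ℂ] K).prodMap (Q : H →ₗ[ℂ] K) := by
  refine LinearMap.ext fun v => ?_
  have hfst : Q (S.fst v.2) = S'.fst (Q v.2) := congr($h.fst v.2)
  have hsnd : Q (S.snd v.1) = S'.snd (Q v.1) := congr($h.snd v.1)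
  simp [d₁, hfst, hsnd]

theorem Intertwines.translate (h : Intertwines Q S S') (l : ℂ × ℂ) :
    Intertwines Q (S.translate l) (S'.translate l) where
  fst := ContinuousLinearMap.ext fun x => by simpa [CommutingPair.translate] using congr($h.fst x)
  snd := ContinuousLinearMap.ext fun x => by simpa [CommutingPair.translate] using congr($h.snd x)

variable [CompleteSpace H] [CompleteSpace K]

theorem FredholmEquivalent.of_linearEquiv (e₀ : S.H₀ ≃ₗ[ℂ] S'.H₀) (e₁ : S.H₁ ≃ₗ[ℂ] S'.H₁)
    (e₂ : S.H₂ ≃ₗ[ℂ] S'.H₂) : FredholmEquivalent S S' where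
  isFredholm_iff := by
    rw [S.isFredholm_iff, S'.isFredholm_iff]
    exact and_congr (Module.Finite.equiv_iff e₀)
      (and_congr (Module.Finite.equiv_iff e₁) (Module.Finite.equiv_iff e₂))
  index_eq _ := by rw [index, index, e₀.finrank_eq, e₁.finrank_eq, e₂.finrank_eq]

theorem FredholmEquivalent.of_isAlgFredholm {φ₀ : S.H₀ →ₗ[ℂ] S'.H₀} {φ₁ : S.H₁ →ₗ[ℂ] S'.H₁}
    {φ₂ : S.H₂ →ₗ[ℂ] S'.H₂} (h₀ : IsAlgFredholm φ₀) (h₁ : IsAlgFredholm φ₁)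
    (h₂ : IsAlgFredholm φ₂) (hindex : φ₀.index - φ₁.index + φ₂.index = 0) :
    FredholmEquivalent S S' := by
  have hiff : S.IsFredholm ↔ S'.IsFredholm := by
    rw [S.isFredholm_iff, S'.isFredholm_iff, h₀.finiteDimensional_iff, h₁.finiteDimensional_iff,
      h₂.finiteDimensional_iff]
  refine ⟨hiff, fun hS => ?_⟩
  obtain ⟨_, _, _⟩ := S.isFredholm_iff.1 hS
  obtain ⟨_, _, _⟩ := S'.isFredholm_iff.1 (hiff.1 hS)
  simp only [LinearMap.index_eq_of_finiteDimensional] at hindex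
  rw [index, index]
  omega

theorem Intertwines.fredholmEquivalent_of_isAlgFredholm (h : Intertwines Q S S')
    (hQ : IsAlgFredholm (Q : H →ₗ[ℂ] K)) : FredholmEquivalent S S' := by
  have hd : (S.d₁ : H × H →ₗ[ℂ] H) ∘ₗ (S.d₀ : H →ₗ[ℂ] H × H) = 0 :=
    congr(($S.d₁_comp_d₀ : H →ₗ[ℂ] H))
  have hd' : (S'.d₁ : K × K →ₗ[ℂ] K) ∘ₗ (S'.d₀ : K →ₗ[ℂ] K × K) = 0 :=
    congr(($S'.d₁_comp_d₀ : K →ₗ[ℂ] K))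
  have hQQ := hQ.prodMap hQ
  refine .of_isAlgFredholm (isAlgFredholm_mapKer h.comp_d₀ hQ hQQ)
    (isAlgFredholm_mapHomology h.comp_d₀ h.comp_d₁ hd hd' hQ hQQ hQ)
    (isAlgFredholm_mapCoker h.comp_d₁ hQQ hQ) ?_
  rw [index_mapKer_sub_index_mapHomology_add_index_mapCoker h.comp_d₀ h.comp_d₁ hd hd' hQ hQQ hQ,
    hQ.index_prodMap hQ]
  ring

theorem Intertwines.fredholmEquivalent_of_vanishesOnHomology (hQ : Intertwines Q S S')
    (hA : Intertwines A S' S) {c : ℂ} (hc : c ≠ 0)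
    (hAQ : S.VanishesOnHomology (A ∘L Q - c • 1)) (hQA : S'.VanishesOnHomology (Q ∘L A - c • 1)) :
    FredholmEquivalent S S' := by
  obtain ⟨e₀⟩ := nonempty_linearEquiv_of_comp_eq_smul hc
    (mapKer_comp_mapKer_eq_smul hQ.comp_d₀ hA.comp_d₀ fun x hx => sub_eq_zero.1 (hAQ.on_H₀ x hx))
    (mapKer_comp_mapKer_eq_smul hA.comp_d₀ hQ.comp_d₀ fun x hx => sub_eq_zero.1 (hQA.on_H₀ x hx))
  obtain ⟨e₁⟩ := nonempty_linearEquiv_of_comp_eq_smul hc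
    (mapHomology_comp_mapHomology_eq_smul hQ.comp_d₀ hQ.comp_d₁ hA.comp_d₀ hA.comp_d₁ hAQ.on_H₁)
    (mapHomology_comp_mapHomology_eq_smul hA.comp_d₀ hA.comp_d₁ hQ.comp_d₀ hQ.comp_d₁ hQA.on_H₁)
  obtain ⟨e₂⟩ := nonempty_linearEquiv_of_comp_eq_smul hc
    (mapCoker_comp_mapCoker_eq_smul hQ.comp_d₁ hA.comp_d₁ hAQ.on_H₂)
    (mapCoker_comp_mapCoker_eq_smul hA.comp_d₁ hQ.comp_d₁ hQA.on_H₂)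
  exact .of_linearEquiv e₀ e₁ e₂

end Homology

section FactorSwap

variable {H K : Type*} [NormedAddCommGroup H] [InnerProductSpace ℂ H]
  [NormedAddCommGroup K] [InnerProductSpace ℂ K]

/-- `S = (A₁ Q, A₂ Q)` and `S' = (Q A₁, Q A₂)` arise from each other by swapping the factor `Q`,
where `(A₁, A₂)` commute across `Q`. -/
structure IsFactorSwap (Q : H →L[ℂ] K) (A₁ A₂ : K →L[ℂ] H) (S : CommutingPair H)
    (S' : CommutingPair K) : Prop where
  fst_left : S.fst = A₁ ∘L Q
  snd_left : S.snd = A₂ ∘L Q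
  fst_right : S'.fst = Q ∘L A₁
  snd_right : S'.snd = Q ∘L A₂
  cross : A₁ ∘L Q ∘L A₂ = A₂ ∘L Q ∘L A₁

namespace IsFactorSwap

variable {S : CommutingPair H} {S' : CommutingPair K} {Q : H →L[ℂ] K} {A₁ A₂ : K →L[ℂ] H}

theorem intertwines (h : IsFactorSwap Q A₁ A₂ S S') : Intertwines Q S S' where
  fst := by rw [h.fst_left, h.fst_right, comp_assoc]
  snd := by rw [h.snd_left, h.snd_right, comp_assoc]

theorem intertwines_fst (h : IsFactorSwap Q A₁ A₂ S S') : Intertwines A₁ S' S where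
  fst := by rw [h.fst_left, h.fst_right, comp_assoc]
  snd := by rw [h.snd_left, h.snd_right, h.cross, comp_assoc]

theorem intertwines_snd (h : IsFactorSwap Q A₁ A₂ S S') : Intertwines A₂ S' S where
  fst := by rw [h.fst_left, h.fst_right, ← h.cross, comp_assoc]
  snd := by rw [h.snd_left, h.snd_right, comp_assoc]

theorem fredholmEquivalent_translate [CompleteSpace H] [CompleteSpace K]
    (h : IsFactorSwap Q A₁ A₂ S S') {l : ℂ × ℂ} (hl : l ≠ 0) :
    FredholmEquivalent (S.translate l) (S'.translate l) := by
  obtain hl₁ | hl₂ : l.1 ≠ 0 ∨ l.2 ≠ 0 := by rwa [Ne, Prod.ext_iff, not_and_or] at hl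
  · refine (h.intertwines.translate l).fredholmEquivalent_of_vanishesOnHomology
      (h.intertwines_fst.translate l) hl₁ ?_ ?_
    · exact h.fst_left ▸ (S.translate l).vanishesOnHomology_fst
    · exact h.fst_right ▸ (S'.translate l).vanishesOnHomology_fst
  · refine (h.intertwines.translate l).fredholmEquivalent_of_vanishesOnHomology
      (h.intertwines_snd.translate l) hl₂ ?_ ?_
    · exact h.snd_left ▸ (S.translate l).vanishesOnHomology_snd
    · exact h.snd_right ▸ (S'.translate l).vanishesOnHomology_snd

end IsFactorSwap

end FactorSwap

section Aluthge

variable {H : Type*} [NormedAddCommGroup H] [InnerProductSpace ℂ H] [CompleteSpace H]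

theorem isFactorSwap_sphericalAluthge (T : CommutingPair H) :
    IsFactorSwap T.sqrtP (T.polar.1 * T.sqrtP) (T.polar.2 * T.sqrtP) T T.sphericalAluthge where
  fst_left := by
    rw [T.polar_spec.fst_eq, ← T.sqrtP_mul_sqrtP]
    rfl
  snd_left := by
    rw [T.polar_spec.snd_eq, ← T.sqrtP_mul_sqrtP]
    rfl
  fst_right := rfl
  snd_right := rfl
  cross := by
    have h := congr($T.polar_comm * T.sqrtP)
    rw [← T.sqrtP_mul_sqrtP] at h
    exact h

theorem injOn_polar_closure_range_P (T : CommutingPair H) :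
    Set.InjOn (T.polar.1.prod T.polar.2) (closure (Set.range T.P)) := by
  intro x hx y hy hxy
  have hker : x - y ∈ T.P.rangeᗮ := by
    rw [orthogonal_range, T.P_isSelfAdjoint, ← T.polar_spec.ker_V]
    exact ⟨LinearMap.sub_mem_ker_iff.2 congr(($hxy).1), LinearMap.sub_mem_ker_iff.2 congr(($hxy).2)⟩
  have hcl : x - y ∈ T.P.rangeᗮᗮ := by
    rw [Submodule.orthogonal_orthogonal_eq_closure]
    exact sub_mem hx hy
  exact sub_eq_zero.1 (Submodule.disjoint_def.1 (Submodule.orthogonal_disjoint _) _ hker hcl)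

theorem IsFredholm.isClosed_range_P {T : CommutingPair H} (h : T.IsFredholm) :
    IsClosed (Set.range T.P) := by
  have hd₀ : T.d₀ = T.polar.1.prod T.polar.2 ∘L T.P := by
    rw [d₀, T.polar_spec.fst_eq, T.polar_spec.snd_eq]
    rfl
  refine isClosed_range_of_isClosed_range_comp (T.polar.1.prod T.polar.2).continuous
    T.injOn_polar_closure_range_P ?_
  have := h.isClosed_range_d₀
  rwa [hd₀] at this

theorem IsFredholm.cofg_range_P {T : CommutingPair H} (h : T.IsFredholm) : T.P.range.CoFG := by
  refine cofg_range_of_isStarNormal (IsSelfAdjoint.isStarNormal T.P_isSelfAdjoint) ?_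
    h.isClosed_range_P
  have hker : T.d₀.ker = T.P.ker := (LinearMap.ker_prod _ _).trans T.polar_spec.ker_T
  exact hker ▸ Module.Finite.iff_fg.1 h.finite_H₀

theorem IsFredholm.cofg_range_sqrtP {T : CommutingPair H} (h : T.IsFredholm) :
    T.sqrtP.range.CoFG := by
  refine h.cofg_range_P.of_le ?_
  rw [← T.sqrtP_mul_sqrtP]
  exact LinearMap.range_comp_le_range _ _

theorem cofg_range_sqrtP_of_isFredholm_sphericalAluthge {T : CommutingPair H}
    (h : T.sphericalAluthge.IsFredholm) : T.sqrtP.range.CoFG := by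
  have hle : T.sphericalAluthge.d₁.range ≤ T.sqrtP.range := by
    rintro _ ⟨v, rfl⟩
    exact ⟨T.polar.1 (T.sqrtP v.2) - T.polar.2 (T.sqrtP v.1), by
      simp [d₁, sphericalAluthge, sub_eq_neg_add]⟩
  exact Submodule.CoFG.of_le hle h.finite_H₂

theorem fredholmEquivalent_sphericalAluthge_of_cofg (T : CommutingPair H)
    (h : T.sqrtP.range.CoFG) : FredholmEquivalent T T.sphericalAluthge :=
  T.isFactorSwap_sphericalAluthge.intertwines.fredholmEquivalent_of_isAlgFredholm
    (.of_isStarNormal_of_cofg (IsSelfAdjoint.isStarNormal T.sqrtP_isSelfAdjoint) h)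

theorem fredholmEquivalent_sphericalAluthge (T : CommutingPair H) :
    FredholmEquivalent T T.sphericalAluthge where
  isFredholm_iff :=
    ⟨fun h => (T.fredholmEquivalent_sphericalAluthge_of_cofg h.cofg_range_sqrtP).isFredholm_iff.1 h,
      fun h => (T.fredholmEquivalent_sphericalAluthge_of_cofg
        (cofg_range_sqrtP_of_isFredholm_sphericalAluthge h)).isFredholm_iff.2 h⟩
  index_eq h := (T.fredholmEquivalent_sphericalAluthge_of_cofg h.cofg_range_sqrtP).index_eq h

theorem fredholmEquivalent_translate_sphericalAluthge (T : CommutingPair H) (l : ℂ × ℂ) :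
    FredholmEquivalent (T.translate l) (T.sphericalAluthge.translate l) := by
  obtain rfl | hl := eq_or_ne l 0
  · simpa only [translate_zero] using T.fredholmEquivalent_sphericalAluthge
  · exact T.isFactorSwap_sphericalAluthge.fredholmEquivalent_translate hl

end Aluthge

end CommutingPair

theorem theorem2p12 {H : Type*} [NormedAddCommGroup H] [InnerProductSpace ℂ H] [CompleteSpace H]
    (T : CommutingPair H) :
    T.essentialSpectrum = T.sphericalAluthge.essentialSpectrum ∧
      ∀ l : ℂ × ℂ, l ∉ T.essentialSpectrum →
        (T.translate l).index = (T.sphericalAluthge.translate l).index := by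
  have hequiv := T.fredholmEquivalent_translate_sphericalAluthge
  exact ⟨Set.ext fun l => not_congr (hequiv l).isFredholm_iff,
    fun l hl => (hequiv l).index_eq (not_not.1 hl)⟩
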